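/- For a set $S\subseteq\mathbb{Z}\setminus\{0\}$ let $\Gamma(\mathbb{Z},S)$ be the digraph with vertex set $\mathbb{Z}$ and edges $(m,m+x)$ for $m\in\mathbb{Z}$, $x\in S$. A set $D\subseteq\mathbb{Z}$ is dominating if for every $v\in\mathbb{Z}$ there is $u\in D$ such that $u=v$ or $(u,v)$ is an edge. The domination ratio $\overline{\gamma}(\mathbb{Z},S)$ is the infimum, over all dominating sets $D$ of $\Gamma(\mathbb{Z},S)$, of the lower density $\liminf_{n\to\infty}|D\cap[-n,n]|/(2n+1)$. Theorem. Let $d$ and $s$ be integers with $d\ge 2$ and $s\notin[0,d-2]$, and suppose that $s=dk+e-1$ or $s=-dk+d-e-1$ for some integers $k\ge 1$ and $e\in\{1,\ldots,d-1\}$. Then $$\overline{\gamma}(\mathbb{Z},\{1,2,\ldots,d-2,s\})=\min\left\{\frac{k+1}{dk+e},\ \frac{2k+e-1}{2dk-d+2e},\ \frac{1}{d-1}\right\}=\begin{cases}\dfrac{k+1}{dk+e} & \text{if } e\ge 2 \text{ and } d\le k+e+1,\\[2mm] \dfrac{2k+e-1}{2dk-d+2e} & \text{if } e=1 \text{ and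 } d\le 2k+2,\\[2mm] \dfrac{1}{d-1} & \text{otherwise.}\end{cases}$$ Here $\{1,2,\ldots,d-2,s\}$ means $\{s\}$ when $d=2$. -/

import Mathlib

/-- The Cayley digraph `Γ(G, S)` of an additive group `G`: its edges are the pairs `(g, g + x)`
with `x ∈ S`. -/
def cayleyDigraph {G : Type*} [AddGroup G] (S : Set G) : Digraph G where
  Adj g h := ∃ x ∈ S, h = g + x

/-- A vertex `u` dominates a vertex `v` if `u = v` or `(u, v)` is an edge. -/
def Digraph.Dominates {V : Type*} (Γ : Digraph V) (u v : V) : Prop :=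
  u = v ∨ Γ.Adj u v

/-- Every vertex is dominated by some vertex of `D`. -/
def Digraph.IsDominatingSet {V : Type*} (Γ : Digraph V) (D : Set V) : Prop :=
  ∀ v : V, ∃ u ∈ D, Γ.Dominates u v

/-- The (lower) density `liminf |U ∩ [-n, n]| / (2n + 1)` of a set of integers, as `n → ∞`. -/
noncomputable def intLowerDensity (U : Set ℤ) : ℝ :=
  Filter.liminf
    (fun n : ℕ => ((U ∩ Set.Icc (-(n : ℤ)) (n : ℤ)).ncard : ℝ) / (2 * (n : ℝ) + 1))
    Filter.atTop

/-- The domination ratio of the integer distance digraph `Γ(ℤ, S)`: the infimum of the lower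
densities of its dominating sets. -/
noncomputable def dominationRatio (S : Set ℤ) : ℝ :=
  sInf (intLowerDensity '' {D : Set ℤ | (cayleyDigraph S).IsDominatingSet D})

/-! A dominating set is a set `D` whose translates of the tile `{0, …, d - 2, s}` cover the
integers. Reflecting the tile exchanges `s` and `d - 2 - s`, so `s = dk + e - 1` may be assumed.
Periodic sets give the upper bounds; the lower bounds are a discharging argument.

A gap of `D` of length at least `d` leaves its last integers uncovered, and `w` uncovered forces `w
- s ∈ D`. Adjacent uncovered integers, which every gap longer than `d` produces, are therefore paid
for by a gap of length `1` located `s` earlier. In a block between two elements of `D`, let `N`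
count the elements of `D`, `R` the uncovered pairs, and `M` the uncovered pairs in the block shifted
by `s`. Summing over gaps (`IsTileCover.length_le`) gives length `≤ R + dN - (d - 1)M`. Since `R -
M` telescopes, `δ(R - M)` can be added to `A * N` without affecting densities, and it suffices to
cut the line into blocks of nonnegative `surplus`. Going left from `x ∈ D`, if `x - 1` is covered
the block is one gap of length at most `d - 1`; otherwise it is `[x - 1 - s, x)`, of length `dk +
e`.

For `e ≥ 2`, and for `e = 1` with `d > 2k + 2`, a suitable `δ` makes every block nonnegative. For `e
= 1` and `d ≤ 2k + 2` there is one bad type: `k` gaps `d` and one gap `1`, of surplus `-(d - 2)`.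
Its uncovered integers, shifted back by `dk`, prescribe elements of `D` in the block to its left.
Unless a surplus appears, that block has `k - 1` gaps `d` and one gap `d + 1` (surplus `0`), and the
next is again bad with its short gap one place further right. The short gap reaches the right end
after finitely many rounds, and the single gap `1` then repays the whole debt
(`IsTileCover.exists_surplus_of_short_gap`). -/

/-! ### Counting in half-open intervals. -/

/-- The number of elements of `Q` in the half-open interval `[a, b)`. -/
noncomputable def intCount (Q : Set ℤ) (a b : ℤ) : ℤ :=
  open Classical in (((Finset.Ico a b).filter (· ∈ Q)).card : ℤ)

theorem intCount_nonneg (Q : Set ℤ) (a b : ℤ) : 0 ≤ intCount Q a b := by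
  unfold intCount; positivity

theorem intCount_le (Q : Set ℤ) {a b : ℤ} (h : a ≤ b) : intCount Q a b ≤ b - a := by
  classical
  unfold intCount
  have := Finset.card_filter_le (Finset.Ico a b) (· ∈ Q)
  rw [Int.card_Ico] at this
  have h2 : ((b - a).toNat : ℤ) = b - a := Int.toNat_of_nonneg (by omega)
  rw [← h2]
  convert (Int.ofNat_le.mpr this)

theorem intCount_add (Q : Set ℤ) {a b c : ℤ} (h : a ≤ b) (h' : b ≤ c) :
    intCount Q a b + intCount Q b c = intCount Q a c := by
  classical
  unfold intCount
  rw [← Nat.cast_add, ← Finset.card_union_of_disjoint, ← Finset.filter_union,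
    Finset.Ico_union_Ico_eq_Ico h h']
  exact Finset.disjoint_filter_filter (Finset.Ico_disjoint_Ico_consecutive a b c)

theorem intCount_mono (Q : Set ℤ) {a b a' b' : ℤ} (h : a' ≤ a) (h' : b ≤ b') :
    intCount Q a b ≤ intCount Q a' b' := by
  classical
  unfold intCount
  exact_mod_cast Finset.card_le_card
    (Finset.filter_subset_filter _ (Finset.Ico_subset_Ico h h'))

theorem card_le_intCount {Q : Set ℤ} {a b : ℤ} (F : Finset ℤ)
    (hF : ∀ x ∈ F, x ∈ Q ∧ a ≤ x ∧ x < b) : (F.card : ℤ) ≤ intCount Q a b := by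
  classical
  unfold intCount
  exact_mod_cast Finset.card_le_card fun x hx => by
    simp only [Finset.mem_filter, Finset.mem_Ico]
    exact ⟨(hF x hx).2, (hF x hx).1⟩

/-- A set of at least as many elements as the count exhausts the counted set. -/
theorem mem_of_intCount_le_card {Q : Set ℤ} {a b : ℤ} (F : Finset ℤ)
    (hF : ∀ x ∈ F, x ∈ Q ∧ a ≤ x ∧ x < b) (hc : intCount Q a b ≤ F.card) {x : ℤ}
    (hx : x ∈ Q) (ha : a ≤ x) (hb : x < b) : x ∈ F := by
  classical
  unfold intCount at hc
  have : F = (Finset.Ico a b).filter (· ∈ Q) := Finset.eq_of_subset_of_card_le (fun x hx => by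
    simp only [Finset.mem_filter, Finset.mem_Ico]
    exact ⟨(hF x hx).2, (hF x hx).1⟩) (by exact_mod_cast hc)
  rw [this]
  simp [hx, ha, hb]

theorem intCount_eq_zero_iff {Q : Set ℤ} {a b : ℤ} :
    intCount Q a b = 0 ↔ ∀ x, a ≤ x → x < b → x ∉ Q := by
  classical
  unfold intCount
  rw [Nat.cast_eq_zero, Finset.card_eq_zero, Finset.filter_eq_empty_iff]
  simp only [Finset.mem_Ico, and_imp]

theorem exists_mem_of_intCount_pos {Q : Set ℤ} {a b : ℤ} (h : 0 < intCount Q a b) :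
    ∃ x ∈ Q, a ≤ x ∧ x < b := by
  by_contra! hc
  have := intCount_eq_zero_iff.2 fun x h1 h2 h3 => absurd h2 (not_lt.2 (hc x h3 h1))
  omega

theorem intCount_Icc (Q : Set ℤ) (n : ℕ) :
    ((Q ∩ Set.Icc (-(n : ℤ)) (n : ℤ)).ncard : ℤ) = intCount Q (-n) (n + 1) := by
  classical
  unfold intCount
  rw [← Set.ncard_coe_finset]
  congr 2
  ext x
  simp only [Set.mem_inter_iff, Set.mem_Icc, Finset.coe_filter, Finset.mem_Ico, Set.mem_ofPred_eq]
  constructor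
  · rintro ⟨h1, h2, h3⟩; exact ⟨⟨h2, by omega⟩, h1⟩
  · rintro ⟨⟨h2, h3⟩, h1⟩; exact ⟨h1, h2, by omega⟩

theorem intCount_eq_one_of_gap {Q : Set ℤ} {a b : ℤ} (ha : a ∈ Q) (hab : a < b)
    (h : ∀ x ∈ Q, a < x → b ≤ x) : intCount Q a b = 1 := by
  have h1 : intCount Q (a + 1) b = 0 := intCount_eq_zero_iff.2 fun x h1 h2 h3 => by
    have := h x h3 (by omega)
    omega
  have h2 := intCount_le Q (a := a) (b := a + 1) (by omega)
  have h3 := intCount_add Q (a := a) (b := a + 1) (c := b) (by omega) (by omega)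
  have h4 := card_le_intCount (Q := Q) (a := a) (b := a + 1) {a} (by simp [ha])
  simp at h4
  omega

/-- The greatest element of `Q` below `x`, when there is one. -/
theorem exists_pred {Q : Set ℤ} {x z : ℤ} (hz : z ∈ Q) (hzx : z < x) :
    ∃ p ∈ Q, z ≤ p ∧ p < x ∧ ∀ v ∈ Q, p < v → x ≤ v := by
  obtain ⟨p, ⟨hp, hpx⟩, hmax⟩ := Int.exists_greatest_of_bdd (P := fun v => v ∈ Q ∧ v < x)
    ⟨x, fun v hv => hv.2.le⟩ ⟨z, hz, hzx⟩
  refine ⟨p, hp, hmax z ⟨hz, hzx⟩, hpx, fun v hv hpv => ?_⟩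
  by_contra! hc
  have := hmax v ⟨hv, hc⟩
  omega

/-! ### From counting bounds to lower density. -/

open Filter Topology in
theorem tendsto_affine_div (c C : ℝ) :
    Tendsto (fun n : ℕ => (c * (2 * (n : ℝ) + 1) + C) / (2 * (n : ℝ) + 1)) atTop (𝓝 c) := by
  have h1 : Tendsto (fun n : ℕ => 2 * (n : ℝ) + 1) atTop atTop :=
    tendsto_atTop_add_const_right _ _
      (Tendsto.const_mul_atTop (by norm_num) tendsto_natCast_atTop_atTop)
  have h2 : Tendsto (fun n : ℕ => c + C / (2 * (n : ℝ) + 1)) atTop (𝓝 (c + 0)) :=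
    tendsto_const_nhds.add (h1.const_div_atTop C)
  rw [add_zero] at h2
  refine h2.congr fun n => ?_
  have : (2 * (n : ℝ) + 1) ≠ 0 := by positivity
  field_simp

theorem density_nonneg (D : Set ℤ) (n : ℕ) :
    0 ≤ ((D ∩ Set.Icc (-(n : ℤ)) (n : ℤ)).ncard : ℝ) / (2 * (n : ℝ) + 1) := by positivity

theorem density_le_one (D : Set ℤ) (n : ℕ) :
    ((D ∩ Set.Icc (-(n : ℤ)) (n : ℤ)).ncard : ℝ) / (2 * (n : ℝ) + 1) ≤ 1 := by
  rw [div_le_one (by positivity)]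
  have h1 := intCount_Icc D n
  have h2 := intCount_le D (a := -n) (b := n + 1) (by omega)
  have : ((D ∩ Set.Icc (-(n : ℤ)) (n : ℤ)).ncard : ℤ) ≤ 2 * n + 1 := by omega
  exact_mod_cast this

open Filter in
theorem le_intLowerDensity_of_count {D : Set ℤ} {c C : ℝ}
    (h : ∀ n : ℕ, c * (2 * (n : ℝ) + 1) - C ≤ (intCount D (-n) (n + 1) : ℝ)) :
    c ≤ intLowerDensity D := by
  have ht := tendsto_affine_div c (-C)
  rw [← ht.liminf_eq]
  refine liminf_le_liminf (Eventually.of_forall fun n => ?_) ht.isBoundedUnder_ge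
    (isCoboundedUnder_ge_of_le atTop (x := 1) (density_le_one D))
  have h1 : ((D ∩ Set.Icc (-(n : ℤ)) (n : ℤ)).ncard : ℝ) = (intCount D (-n) (n + 1) : ℝ) := by
    exact_mod_cast intCount_Icc D n
  rw [h1]
  gcongr
  linarith [h n]

open Filter in
theorem intLowerDensity_le_of_count {D : Set ℤ} {c C : ℝ}
    (h : ∀ n : ℕ, (intCount D (-n) (n + 1) : ℝ) ≤ c * (2 * (n : ℝ) + 1) + C) :
    intLowerDensity D ≤ c := by
  have ht := tendsto_affine_div c C
  rw [← ht.liminf_eq]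
  refine liminf_le_liminf (Eventually.of_forall fun n => ?_)
    (isBoundedUnder_of ⟨0, density_nonneg D⟩) ht.isCoboundedUnder_ge
  have h1 : ((D ∩ Set.Icc (-(n : ℤ)) (n : ℤ)).ncard : ℝ) = (intCount D (-n) (n + 1) : ℝ) := by
    exact_mod_cast intCount_Icc D n
  rw [h1]
  gcongr
  exact h n

/-- If every element of `D` ends a bounded block on which the count of `D`, corrected by a bounded
potential, is at least `B / A` times the length, then `D` has lower density at least `B / A`. -/
theorem le_intLowerDensity_of_blocks {D : Set ℤ} {A B C K : ℤ} {Φ : ℤ → ℤ} (hA : 0 < A)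
    (hB : 0 ≤ B) (hΦ : ∀ x, 0 ≤ Φ x ∧ Φ x ≤ C) (hK : ∀ m, ∃ x ∈ D, m - K ≤ x ∧ x ≤ m)
    (hstep : ∀ x ∈ D, ∃ z ∈ D, z < x ∧ x - K ≤ z ∧
      B * (x - z) + Φ x ≤ A * intCount D z x + Φ z) :
    (B : ℝ) / A ≤ intLowerDensity D := by
  -- Chaining blocks downwards from `x` reaches an element of `D` at most `m`, overshooting `m` by
  -- at most `K`.
  have descend : ∀ (t : ℕ) (m x : ℤ), x ∈ D → x - m = t → ∃ z ∈ D, z ≤ m ∧ m - K ≤ z ∧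
      B * (x - z) + Φ x ≤ A * intCount D z x + Φ z := by
    intro t
    induction t using Nat.strong_induction_on with
    | _ t ih =>
      intro m x hx hxm
      obtain ⟨z, hz, hzx, hzK, hineq⟩ := hstep x hx
      rcases le_or_gt z m with hzm | hzm
      · exact ⟨z, hz, hzm, by omega, hineq⟩
      · obtain ⟨w, hw, hwm, hwK, hw'⟩ := ih (z - m).toNat (by omega) m z hz (by omega)
        refine ⟨w, hw, hwm, hwK, ?_⟩
        have := intCount_add D (a := w) (b := z) (c := x) (by omega) hzx.le
        rw [← this]
        linarith
  have hK0 : 0 ≤ K := by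
    obtain ⟨x, -, h1, h2⟩ := hK 0
    omega
  have hA' : (0 : ℝ) < A := by exact_mod_cast hA
  -- Boundary losses: the top element may be as low as `n - K`, the chain may overhang `-n` by `K`,
  -- and the potential contributes at most `C`.
  refine le_intLowerDensity_of_count (C := (B * (K + 1) + C + A * K : ℤ) / (A : ℝ)) fun n => ?_
  have key : B * (2 * n + 1) - (B * (K + 1) + C + A * K) ≤ A * intCount D (-n) (n + 1) := by
    obtain ⟨x, hx, hx1, hx2⟩ := hK n
    have hC := hΦ x
    rcases le_or_gt (-n : ℤ) x with hnx | hnx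
    · obtain ⟨z, hz, hzm, hzK, hineq⟩ := descend (x + n).toNat (-n) x hx (by omega)
      have h1 := intCount_add D (a := z) (b := -n) (c := x) hzm hnx
      have h2 := intCount_le D hzm
      have h3 := intCount_mono D (a := -n) (b := x) (a' := -n) (b' := n + 1) le_rfl (by omega)
      have hz := hΦ z
      have h4 : A * intCount D z x ≤ A * (intCount D (-n) (n + 1) + K) :=
        mul_le_mul_of_nonneg_left (by omega) hA.le
      have h5 : B * (2 * n - K) ≤ B * (x - z) := mul_le_mul_of_nonneg_left (by omega) hB
      linarith
    · have h1 : 0 ≤ A * intCount D (-n) (n + 1) := mul_nonneg hA.le (intCount_nonneg _ _ _)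
      have h2 : B * (2 * n - K) ≤ B * 0 := mul_le_mul_of_nonneg_left (by omega) hB
      have h3 : 0 ≤ A * K := mul_nonneg hA.le hK0
      linarith
  have key' : (B : ℝ) * (2 * n + 1) - (B * (K + 1) + C + A * K : ℤ)
      ≤ A * (intCount D (-n) (n + 1) : ℝ) := by exact_mod_cast key
  have : (B : ℝ) / A * (2 * n + 1) - (B * (K + 1) + C + A * K : ℤ) / (A : ℝ)
      = (B * (2 * n + 1) - (B * (K + 1) + C + A * K : ℤ)) / A := by ring
  rw [this, div_le_iff₀ hA']
  linarith

/-! ### Uncovered integers, the gap inequality and the discharging scheme. -/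

/-- `w` is not in any of the intervals `[v, v + d - 2]` with `v ∈ D`. -/
def IsUncovered (d : ℤ) (D : Set ℤ) (w : ℤ) : Prop := ∀ v ∈ D, ¬(w - (d - 2) ≤ v ∧ v ≤ w)

/-- The left elements of the pairs of adjacent uncovered integers. -/
def uncoveredPairs (d : ℤ) (D : Set ℤ) : Set ℤ :=
  {w | IsUncovered d D w ∧ IsUncovered d D (w + 1)}

/-- The tile `{0, …, d - 2, s}` translated by the elements of `D` covers the integers. -/
def IsTileCover (d s : ℤ) (D : Set ℤ) : Prop := ∀ w, IsUncovered d D w → w - s ∈ D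

/-- The amount by which `A` times the corrected number of elements of `D` in `[a, b)` exceeds `B`
times the length. The correction is a telescoping one: each pair of adjacent uncovered integers
receives `δ` from the pair of adjacent elements of `D` located `s` before it. -/
noncomputable def surplus (A B δ d s : ℤ) (D : Set ℤ) (a b : ℤ) : ℤ :=
  A * intCount D a b - B * (b - a) +
    δ * (intCount (uncoveredPairs d D) a b - intCount (uncoveredPairs d D) (a + s) (b + s))

theorem surplus_add (A B δ d s : ℤ) (D : Set ℤ) {a b c : ℤ} (h : a ≤ b) (h' : b ≤ c) :
    surplus A B δ d s D a b + surplus A B δ d s D b c = surplus A B δ d s D a c := by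
  unfold surplus
  rw [← intCount_add D h h', ← intCount_add (uncoveredPairs d D) h h',
    ← intCount_add (uncoveredPairs d D) (a := a + s) (b := b + s) (c := c + s)
      (by omega) (by omega)]
  ring

theorem not_isUncovered_iff {d : ℤ} {D : Set ℤ} {w : ℤ} :
    ¬IsUncovered d D w ↔ ∃ v ∈ D, w - (d - 2) ≤ v ∧ v ≤ w := by
  simp [IsUncovered]

section
variable {d s : ℤ} {D : Set ℤ}

theorem IsUncovered.notMem (hd : 2 ≤ d) {w : ℤ} (h : IsUncovered d D w) : w ∉ D :=
  fun hw => h w hw ⟨by omega, le_rfl⟩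

theorem IsTileCover.exists_pred (hD : IsTileCover d s D) (hd : 2 ≤ d) (hs : 0 ≤ s) (x : ℤ) :
    ∃ p ∈ D, x - (s + d) ≤ p ∧ p < x ∧ ∀ v ∈ D, p < v → x ≤ v := by
  have : ∃ z ∈ D, x - (s + d) ≤ z ∧ z < x := by
    by_cases h : IsUncovered d D (x - 1)
    · exact ⟨_, hD _ h, by omega, by omega⟩
    · obtain ⟨v, hv, h1, h2⟩ := not_isUncovered_iff.1 h
      exact ⟨v, hv, by omega, by omega⟩
  obtain ⟨z, hz, hz1, hz2⟩ := this
  obtain ⟨p, hp, h1, h2, h3⟩ := _root_.exists_pred hz hz2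
  exact ⟨p, hp, by omega, h2, h3⟩

theorem mem_of_mem_uncoveredPairs (hD : IsTileCover d s D) {v : ℤ}
    (h : v + s ∈ uncoveredPairs d D) : v ∈ D ∧ v + 1 ∈ D := by
  have h1 := hD _ h.1
  have h2 := hD _ h.2
  exact ⟨by simpa using h1, by convert h2 using 1; ring⟩

theorem intCount_uncoveredPairs_shift_eq_zero {a b : ℤ}
    (h : ∀ v, a ≤ v → v < b → v + s ∉ uncoveredPairs d D) :
    intCount (uncoveredPairs d D) (a + s) (b + s) = 0 :=
  intCount_eq_zero_iff.2 fun w h1 h2 => by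
    simpa using h (w - s) (by omega) (by omega)

/-- An uncovered pair at `v + s` puts both `v` and `v + 1` in `D`, so only a gap of length `1` can
be charged, and at most once. -/
theorem IsTileCover.gap_shift (hD : IsTileCover d s D) {p x : ℤ} (hpx : p < x)
    (hgap : ∀ v ∈ D, p < v → x ≤ v) :
    intCount (uncoveredPairs d D) (p + s) (x + s) = 0 ∨
      (x = p + 1 ∧ intCount (uncoveredPairs d D) (p + s) (x + s) ≤ 1) := by
  by_cases hx : x = p + 1
  · right
    refine ⟨hx, ?_⟩
    have := intCount_le (uncoveredPairs d D) (a := p + s) (b := x + s) (by omega)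
    omega
  · left
    refine intCount_uncoveredPairs_shift_eq_zero fun v h1 h2 h3 => ?_
    obtain ⟨hv, hv'⟩ := mem_of_mem_uncoveredPairs hD h3
    rcases h1.eq_or_lt with rfl | h1
    · have := hgap _ hv' (by omega)
      omega
    · have := hgap _ hv h1
      omega

/-- A gap of length `g ≥ d` contains `g - d` uncovered pairs. A charged gap has length `1 = d - (d -
1)`, which explains the coefficient of the shifted count. -/
theorem IsTileCover.gap_le (hD : IsTileCover d s D) (hd : 2 ≤ d) {p x : ℤ} (hp : p ∈ D)
    (hpx : p < x) (hgap : ∀ v ∈ D, p < v → x ≤ v) :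
    x - p ≤ intCount (uncoveredPairs d D) p x + d * intCount D p x
      - (d - 1) * intCount (uncoveredPairs d D) (p + s) (x + s) := by
  rw [intCount_eq_one_of_gap hp hpx hgap]
  have h0 := intCount_nonneg (uncoveredPairs d D) p x
  rcases hD.gap_shift hpx hgap with h | ⟨h, h'⟩
  · rw [h]
    -- The uncovered integers of the gap are `p + d - 1, …, x - 1`, so pairs start at `p + d - 1, …,
    -- x - 2`; the interval is empty for gaps of length at most `d`.
    have h1 := card_le_intCount (Q := uncoveredPairs d D) (a := p) (b := x)
      (Finset.Ico (p + d - 1) (x - 1)) (by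
        intro w hw
        rw [Finset.mem_Ico] at hw
        refine ⟨⟨fun v hv h => ?_, fun v hv h => ?_⟩, by omega, by omega⟩
        · have := hgap v hv (by omega)
          omega
        · have := hgap v hv (by omega)
          omega)
    rw [Int.card_Ico] at h1
    omega
  · have : (d - 1) * intCount (uncoveredPairs d D) (p + s) (x + s) ≤ (d - 1) * 1 :=
      mul_le_mul_of_nonneg_left h' (by omega)
    omega

theorem IsTileCover.length_le (hD : IsTileCover d s D) (hd : 2 ≤ d) (hs : 0 ≤ s) {a b : ℤ}
    (ha : a ∈ D) (hab : a ≤ b) (hb : b ∈ D) :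
    b - a ≤ intCount (uncoveredPairs d D) a b + d * intCount D a b
      - (d - 1) * intCount (uncoveredPairs d D) (a + s) (b + s) := by
  obtain ⟨t, ht⟩ : ∃ t : ℕ, b - a = t := ⟨(b - a).toNat, by omega⟩
  induction t using Nat.strong_induction_on generalizing b with
  | _ t ih =>
    rcases hab.eq_or_lt with rfl | hab
    · simp [intCount]
    · obtain ⟨p, hp, -, hpb, hgap⟩ := hD.exists_pred hd hs b
      have hap : a ≤ p := by
        by_contra! h
        have := hgap a ha h
        omega
      have h1 := ih (p - a).toNat (by omega) hap hp (by omega)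
      have h2 := hD.gap_le hd hp hpb hgap
      have h3 := intCount_add D hap hpb.le
      have h4 := intCount_add (uncoveredPairs d D) hap hpb.le
      have h5 := intCount_add (uncoveredPairs d D) (a := a + s) (b := p + s) (c := b + s)
        (by omega) (by omega)
      rw [← h3, ← h4, ← h5]
      linarith

/-- The correction over `[z, x)` equals `Φ z - Φ x` for the potential `Φ` counting, with weight `δ`,
the uncovered pairs in a window of length `s`; hence it is bounded by `δ * s`. -/
theorem IsTileCover.le_intLowerDensity (hD : IsTileCover d s D) (hd : 2 ≤ d) (hs : 0 ≤ s)
    {A B δ K : ℤ} (hA : 0 < A) (hB : 0 ≤ B) (hδ : 0 ≤ δ)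
    (hstep : ∀ x ∈ D, ∃ z ∈ D, z < x ∧ x - K ≤ z ∧ 0 ≤ surplus A B δ d s D z x) :
    (B : ℝ) / A ≤ intLowerDensity D := by
  refine le_intLowerDensity_of_blocks (C := δ * s) (K := max K (s + d))
    (Φ := fun x => δ * intCount (uncoveredPairs d D) x (x + s)) hA hB (fun x => ?_) (fun m => ?_)
    (fun x hx => ?_)
  · refine ⟨mul_nonneg hδ (intCount_nonneg _ _ _), mul_le_mul_of_nonneg_left ?_ hδ⟩
    have := intCount_le (uncoveredPairs d D) (a := x) (b := x + s) (by omega)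
    omega
  · obtain ⟨p, hp, h1, h2, -⟩ := hD.exists_pred hd hs m
    exact ⟨p, hp, by omega, by omega⟩
  · obtain ⟨z, hz, hzx, hzK, h⟩ := hstep x hx
    refine ⟨z, hz, hzx, by omega, ?_⟩
    unfold surplus at h
    have h1 := intCount_add (uncoveredPairs d D) (a := z) (b := z + s) (c := x + s)
      (by omega) (by omega)
    have h2 := intCount_add (uncoveredPairs d D) (a := z) (b := x) (c := x + s)
      (by omega) (by omega)
    have h3 : intCount (uncoveredPairs d D) z x - intCount (uncoveredPairs d D) (z + s) (x + s) =
      intCount (uncoveredPairs d D) z (z + s) - intCount (uncoveredPairs d D) x (x + s) := by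
      omega
    rw [h3] at h
    linarith

/-- The blocks used in the lower bounds: a gap of length at most `d - 1`, or an interval
`[x - 1 - s, x)` with `x - 1` uncovered. -/
theorem IsTileCover.le_intLowerDensity_of_cases (hD : IsTileCover d s D) (hd : 2 ≤ d)
    (hs : 0 ≤ s) {A B δ K : ℤ} (hA : 0 < A) (hB : 0 ≤ B) (hδ : 0 ≤ δ)
    (hshort : B * (d - 1) ≤ A) (hone : B + δ ≤ A)
    (hlong : ∀ x ∈ D, IsUncovered d D (x - 1) → x - 1 - s ∈ D →
      ∃ z ∈ D, z < x ∧ x - K ≤ z ∧ 0 ≤ surplus A B δ d s D z x) :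
    (B : ℝ) / A ≤ intLowerDensity D := by
  refine hD.le_intLowerDensity hd hs (K := max K d) hA hB hδ fun x hx => ?_
  by_cases h : IsUncovered d D (x - 1)
  · obtain ⟨z, hz, hzx, hzK, h⟩ := hlong x hx h (hD _ h)
    exact ⟨z, hz, hzx, by omega, h⟩
  · obtain ⟨v, hv, h1, h2⟩ := not_isUncovered_iff.1 h
    obtain ⟨p, hp, h3, hpx, hgap⟩ := _root_.exists_pred hv (x := x) (by omega)
    refine ⟨p, hp, hpx, by omega, ?_⟩
    unfold surplus
    rw [intCount_eq_one_of_gap hp hpx hgap]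
    have h0 := mul_nonneg hδ (intCount_nonneg (uncoveredPairs d D) p x)
    rcases hD.gap_shift hpx hgap with h | ⟨h, h'⟩
    · have : B * (x - p) ≤ B * (d - 1) := mul_le_mul_of_nonneg_left (by omega) hB
      rw [h]
      linarith
    · have := mul_le_mul_of_nonneg_left h' hδ
      have : B * (x - p) = B := by rw [h]; ring
      rw [this, mul_sub]
      linarith
end

/-! ### Lower bound for `e = 1`, `d ≤ 2k + 2`: chains of bad blocks. -/

section
variable {d s k : ℤ} {D : Set ℤ}

/-- Two arithmetic progressions of difference `d`, based at `z` and at `z + 1`. -/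
noncomputable def brokenProgression (d k z j₁ j₂ : ℤ) : Finset ℤ :=
  (Finset.Icc 0 j₁).image (fun i => z + i * d) ∪
    (Finset.Icc j₂ (k - 1)).image (fun i => z + 1 + i * d)

theorem mem_brokenProgression {z j₁ j₂ v : ℤ} : v ∈ brokenProgression d k z j₁ j₂ ↔
    (∃ i, 0 ≤ i ∧ i ≤ j₁ ∧ v = z + i * d) ∨
      (∃ i, j₂ ≤ i ∧ i ≤ k - 1 ∧ v = z + 1 + i * d) := by
  simp only [brokenProgression, Finset.mem_union, Finset.mem_image, Finset.mem_Icc, and_assoc,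
    eq_comm]

theorem card_brokenProgression (hd : 2 ≤ d) {z j₁ j₂ : ℤ} (h0 : 0 ≤ j₁) (h : j₁ ≤ j₂)
    (hk : j₂ ≤ k) : ((brokenProgression d k z j₁ j₂).card : ℤ) = j₁ + 1 + (k - j₂) := by
  have hinj : ∀ c : ℤ, Function.Injective (fun i : ℤ => c + i * d) := fun c i i' hi => by
    have : i * d = i' * d := by simpa using hi
    exact mul_right_cancel₀ (by omega) this
  rw [brokenProgression, Finset.card_union_of_disjoint,
    Finset.card_image_of_injective _ (hinj z), Finset.card_image_of_injective _ (hinj (z + 1)),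
    Int.card_Icc, Int.card_Icc]
  · omega
  · rw [Finset.disjoint_left]
    simp only [Finset.mem_image, Finset.mem_Icc, not_exists, not_and]
    rintro v ⟨i, hi, rfl⟩ i' hi' heq
    have : i * d ≤ i' * d := mul_le_mul_of_nonneg_right (by omega) (by omega)
    omega

theorem brokenProgression_bounds (hd : 2 ≤ d) {z j₁ j₂ v : ℤ} (h0 : 0 ≤ j₁) (h : j₁ ≤ j₂)
    (hk : j₁ ≤ k) (hv : v ∈ brokenProgression d k z j₁ j₂) : z ≤ v ∧ v < z + d * k + 1 := by
  rcases mem_brokenProgression.1 hv with ⟨i, hi0, hi, rfl⟩ | ⟨i, hi, hik, rfl⟩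
  · have h1 : i * d ≤ k * d := mul_le_mul_of_nonneg_right (by omega) (by omega)
    have h2 : 0 ≤ i * d := mul_nonneg hi0 (by omega)
    rw [mul_comm d k]
    omega
  · have h1 : i * d ≤ (k - 1) * d := mul_le_mul_of_nonneg_right (by omega) (by omega)
    have h2 : 0 ≤ i * d := mul_nonneg (by omega) (by omega)
    rw [sub_mul] at h1
    rw [mul_comm d k]
    omega

/-- On `[z, z + dk]` the next element after a member is normally `d` further on, leaving one integer
uncovered; a gap `d + 1` (when `j₂ = j₁ + 1`) leaves two. This lemma and its `right` companion list
these integers, whose shifts by `-dk` are the elements of `D` forced in the block to the left. -/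
theorem isUncovered_of_brokenProgression_left (hd : 2 ≤ d) {z j₁ j₂ : ℤ}
    (hpat : ∀ v ∈ D, z ≤ v → v < z + d * k + 1 → v ∈ brokenProgression d k z j₁ j₂) {i : ℤ}
    (hi : 1 ≤ i) (hij : i ≤ j₂) (hik : i ≤ k) : IsUncovered d D (z + i * d - 1) := by
  rintro v hv ⟨h1, h2⟩
  have h3 : i * d ≤ k * d := mul_le_mul_of_nonneg_right (by omega) (by omega)
  have h4 : 1 * d ≤ i * d := mul_le_mul_of_nonneg_right (by omega) (by omega)
  rw [mul_comm k d] at h3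
  rcases mem_brokenProgression.1 (hpat v hv (by omega) (by omega)) with
    ⟨l, -, -, rfl⟩ | ⟨l, hl, -, rfl⟩
  · rcases le_or_gt i l with hil | hil
    · have : i * d ≤ l * d := mul_le_mul_of_nonneg_right hil (by omega)
      omega
    · have : l * d ≤ (i - 1) * d := mul_le_mul_of_nonneg_right (by omega) (by omega)
      rw [sub_mul] at this
      omega
  · have : i * d ≤ l * d := mul_le_mul_of_nonneg_right (by omega) (by omega)
    omega

theorem isUncovered_of_brokenProgression_right (hd : 2 ≤ d) {z j₁ j₂ : ℤ} (h0 : 0 ≤ j₁)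
    (hpat : ∀ v ∈ D, z ≤ v → v < z + d * k + 1 → v ∈ brokenProgression d k z j₁ j₂) {i : ℤ}
    (hi : j₁ < i) (hik : i ≤ k) : IsUncovered d D (z + i * d) := by
  rintro v hv ⟨h1, h2⟩
  have h3 : i * d ≤ k * d := mul_le_mul_of_nonneg_right (by omega) (by omega)
  have h4 : 1 * d ≤ i * d := mul_le_mul_of_nonneg_right (by omega) (by omega)
  rw [mul_comm k d] at h3
  rcases mem_brokenProgression.1 (hpat v hv (by omega) (by omega)) with
    ⟨l, -, hl, rfl⟩ | ⟨l, -, -, rfl⟩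
  · have : l * d ≤ (i - 1) * d := mul_le_mul_of_nonneg_right (by omega) (by omega)
    rw [sub_mul] at this
    omega
  · rcases le_or_gt i l with hil | hil
    · have : i * d ≤ l * d := mul_le_mul_of_nonneg_right hil (by omega)
      omega
    · have : l * d ≤ (i - 1) * d := mul_le_mul_of_nonneg_right (by omega) (by omega)
      rw [sub_mul] at this
      omega

theorem intCount_uncoveredPairs_pred (hd : 2 ≤ d) {y b : ℤ} (hy : y ∈ D) (hb : y ≤ b) :
    intCount (uncoveredPairs d D) (y - 1) b = intCount (uncoveredPairs d D) y b := by
  rw [← intCount_add (uncoveredPairs d D) (a := y - 1) (b := y) (by omega) hb]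
  have : intCount (uncoveredPairs d D) (y - 1) y = 0 := intCount_eq_zero_iff.2 fun w h1 h2 h3 => by
    have : w + 1 = y := by omega
    exact h3.2.notMem hd (this ▸ hy)
  omega

theorem two_le_intCount {Q : Set ℤ} {a v b : ℤ} (ha : a ∈ Q) (hv : v ∈ Q) (hav : a < v)
    (hvb : v < b) : 2 ≤ intCount Q a b := by
  have := card_le_intCount (Q := Q) (a := a) (b := b) {a, v} (by
    simp only [Finset.mem_insert, Finset.mem_singleton]
    rintro x (rfl | rfl)
    · exact ⟨ha, by omega, by omega⟩
    · exact ⟨hv, by omega, by omega⟩)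
  rw [Finset.card_pair hav.ne] at this
  exact_mod_cast this

/-- The continuation to the left of a block consisting of `k - 1` gaps `d` and one gap `d + 1`,
the latter at position `j`. -/
theorem IsTileCover.exists_surplus_of_long_gap (hD : IsTileCover d (d * k) D) (hd : 2 ≤ d)
    (hdk : d ≤ 2 * k + 2) {j y K : ℤ} (hj : 1 ≤ j) (hjk : j ≤ k - 1) (hy : y ∈ D)
    (hK : d * k + 1 ≤ K)
    (hpairs : intCount (uncoveredPairs d D) y (y + d * k) ≤ 1)
    (hleft : ∀ i, 1 ≤ i → i ≤ j + 1 → y - 1 - d * k + i * d ∈ D)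
    (hright : ∀ i, j + 1 ≤ i → i ≤ k - 1 → y - d * k + i * d ∈ D)
    (ih : ∀ y' ∈ D, j + 1 ≤ k - 1 → y' = y - 1 - d * k →
      intCount (uncoveredPairs d D) y' (y' + d * k) = 0 →
      (∀ i, 1 ≤ i → i ≤ j + 1 → y' - 1 - d * k + i * d ∈ D) →
      (∀ i, j + 1 < i → i ≤ k - 1 → y' - d * k + i * d ∈ D) →
      ∃ z ∈ D, z < y' ∧ y - K ≤ z ∧
        (j + 1) * (d - 2) ≤ surplus (2 * d * k - d + 2) (2 * k) (k * d) d (d * k) D z y') :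
    ∃ z ∈ D, z < y ∧ y - K ≤ z ∧
      j * (d - 2) ≤ surplus (2 * d * k - d + 2) (2 * k) (k * d) d (d * k) D z y := by
  have hkd : 0 ≤ k * d := mul_nonneg (by omega) (by omega)
  have hdk2 : d * 2 ≤ d * k := mul_le_mul_of_nonneg_left (by omega) (by omega)
  have hM : ∀ a, y - 1 - d * k ≤ a → a ≤ y →
      -- The shifted window may begin one integer before `y`, but no uncovered pair starts at `y -
      -- 1` because `y ∈ D`.
      intCount (uncoveredPairs d D) (a + d * k) (y + d * k) ≤ 1 := by
    intro a h1 h2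
    have h3 := intCount_mono (uncoveredPairs d D) (a := a + d * k) (b := y + d * k)
      (a' := y - 1) (b' := y + d * k) (by omega) le_rfl
    rw [intCount_uncoveredPairs_pred hd hy (by omega)] at h3
    omega
  have hj' : j * (d - 2) ≤ (k - 1) * (d - 2) := mul_le_mul_of_nonneg_right hjk (by omega)
  -- Here the short gap has reached the right end: `[y - 1, y)` alone has surplus at least `A - B -
  -- kd = (k - 1)(d - 2)`, exactly the `j(d - 2)` required.
  by_cases hjk' : j + 1 = k
  · have hy1 : y - 1 ∈ D := by
      have := hleft k (by omega) (by omega)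
      convert this using 1
      ring
    refine ⟨y - 1, hy1, by omega, by omega, ?_⟩
    unfold surplus
    rw [intCount_eq_one_of_gap hy1 (by omega) (fun x _ _ => by omega)]
    have h1 := intCount_nonneg (uncoveredPairs d D) (y - 1) y
    have h2 := hM (y - 1) (by omega) (by omega)
    have := mul_le_mul_of_nonneg_left (sub_le_sub h1 h2) hkd
    linarith
  by_cases hcov : IsUncovered d D (y - 1)
  · have hz := hD _ hcov
    have hKz : y - 1 - d * k < y := by omega
    have hF : ∀ x ∈ brokenProgression d k (y - 1 - d * k) (j + 1) (j + 1),
        x ∈ D ∧ y - 1 - d * k ≤ x ∧ x < y := by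
      intro x hx
      have hb := brokenProgression_bounds hd (by omega) (by omega) (by omega) hx
      refine ⟨?_, hb.1, by omega⟩
      rcases mem_brokenProgression.1 hx with ⟨i, hi0, hi, rfl⟩ | ⟨i, hi, hik, rfl⟩
      · rcases hi0.eq_or_lt with rfl | hi0
        · simpa using hz
        · exact hleft i (by omega) hi
      · convert hright i (by omega) (by omega) using 1
        ring
    have hN := card_le_intCount _ hF
    have hcard := card_brokenProgression (k := k) hd (z := y - 1 - d * k) (j₁ := j + 1)
      (j₂ := j + 1) (by omega) le_rfl (by omega)
    have hM1 := hM (y - 1 - d * k) (by omega) (by omega)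
    have hR0 := intCount_nonneg (uncoveredPairs d D) (y - 1 - d * k) y
    have hM0 := intCount_nonneg (uncoveredPairs d D) (y - 1 - d * k + d * k) (y + d * k)
    have hS : surplus (2 * d * k - d + 2) (2 * k) (k * d) d (d * k) D (y - 1 - d * k) y =
        (2 * d * k - d + 2) * (intCount D (y - 1 - d * k) y - k) +
        k * d * (intCount (uncoveredPairs d D) (y - 1 - d * k) y -
          intCount (uncoveredPairs d D) (y - 1 - d * k + d * k) (y + d * k) - 1) := by
      unfold surplus
      ring
    generalize hNe : intCount D (y - 1 - d * k) y = N at *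
    generalize hRe : intCount (uncoveredPairs d D) (y - 1 - d * k) y = R at *
    generalize hMe : intCount (uncoveredPairs d D) (y - 1 - d * k + d * k) (y + d * k) = M at *
    -- A bad block again, with short gap at position `j + 1`; its `-(d - 2)` turns the `(j + 1)(d -
    -- 2)` supplied further left into `j(d - 2)`.
    by_cases hbad : N = k + 1 ∧ R = 0 ∧ M = 1
    · have hpat : ∀ v ∈ D, y - 1 - d * k ≤ v → v < y - 1 - d * k + d * k + 1 →
          v ∈ brokenProgression d k (y - 1 - d * k) (j + 1) (j + 1) := fun v hv h1 h2 =>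
        mem_of_intCount_le_card _ hF (by omega) hv h1 (by omega)
      obtain ⟨w, hw, hwz, hwK, hsur⟩ := ih _ hz (by omega) rfl (by
          have h1 := intCount_mono (uncoveredPairs d D) (a := y - 1 - d * k)
            (b := y - 1 - d * k + d * k) (a' := y - 1 - d * k) (b' := y) le_rfl (by omega)
          have h2 := intCount_nonneg (uncoveredPairs d D) (y - 1 - d * k) (y - 1 - d * k + d * k)
          omega)
        (fun i h1 h2 => by
          convert hD _ (isUncovered_of_brokenProgression_left hd hpat h1 h2 (by omega)) using 1
          ring)
        (fun i h1 h2 => by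
          convert hD _ (isUncovered_of_brokenProgression_right hd (by omega) hpat h1
            (by omega)) using 1
          ring)
      refine ⟨w, hw, by omega, hwK, ?_⟩
      rw [← surplus_add _ _ _ _ _ _ hwz.le hKz.le, hS, hbad.1, hbad.2.1, hbad.2.2]
      linarith
    · refine ⟨_, hz, hKz, by omega, ?_⟩
      rw [hS]
      have hA : 0 ≤ 2 * d * k - d + 2 := by nlinarith
      rcases le_or_gt (k + 2) N with h | h
      · have h1 := mul_le_mul_of_nonneg_left (show (2 : ℤ) ≤ N - k by omega) hA
        have h2 := mul_le_mul_of_nonneg_left (show (-2 : ℤ) ≤ R - M - 1 by omega) hkd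
        nlinarith
      · have h1 : N - k = 1 := by omega
        have h2 := mul_le_mul_of_nonneg_left (show (-1 : ℤ) ≤ R - M - 1 by omega) hkd
        rw [h1]
        nlinarith
  · obtain ⟨v, hv, h1, h2⟩ := not_isUncovered_iff.1 hcov
    have hyd : y - d ∈ D := by
      convert hright (k - 1) (by omega) (by omega) using 1
      ring
    refine ⟨y - d, hyd, by omega, by omega, ?_⟩
    -- Two elements in length `d` give at least `2A - 2kd - kd = kd - 2d + 4`, which is at least `(k
    -- - 1)(d - 2)` precisely when `d ≤ 2k + 2`.
    have hN := two_le_intCount hyd hv (b := y) (by omega) (by omega)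
    have hR0 := intCount_nonneg (uncoveredPairs d D) (y - d) y
    have hM1 := hM (y - d) (by omega) (by omega)
    unfold surplus
    have hA : 0 ≤ 2 * d * k - d + 2 := by nlinarith
    have h3 := mul_le_mul_of_nonneg_left hN hA
    have h4 := mul_le_mul_of_nonneg_left (sub_le_sub hR0 hM1) hkd
    linarith

/-- The continuation to the left of a block consisting of `k` gaps `d` and one gap `1`, the latter
at position `j`. -/
theorem IsTileCover.exists_surplus_of_short_gap (hD : IsTileCover d (d * k) D) (hd : 2 ≤ d)
    (hdk : d ≤ 2 * k + 2) (t : ℕ) {j y : ℤ} (ht : k - 1 - j = t) (hj : 1 ≤ j) (hy : y ∈ D)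
    (hpairs : intCount (uncoveredPairs d D) y (y + d * k) = 0)
    (hleft : ∀ i, 1 ≤ i → i ≤ j → y - 1 - d * k + i * d ∈ D)
    (hright : ∀ i, j < i → i ≤ k - 1 → y - d * k + i * d ∈ D) :
    ∃ z ∈ D, z < y ∧ y - (t + 1) * (2 * (d * k + 1)) ≤ z ∧
      j * (d - 2) ≤ surplus (2 * d * k - d + 2) (2 * k) (k * d) d (d * k) D z y := by
  induction t using Nat.strong_induction_on generalizing j y with
  | _ t ih =>
  have hjk : j ≤ k - 1 := by omega
  have hkd : 0 ≤ k * d := mul_nonneg (by omega) (by omega)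
  have hdk2 : d * 2 ≤ d * k := mul_le_mul_of_nonneg_left (by omega) (by omega)
  have hA : 0 ≤ 2 * d * k - d + 2 := by nlinarith
  have hKt : 2 * (d * k + 1) ≤ (t + 1) * (2 * (d * k + 1)) := by nlinarith
  have hM : ∀ a, y - 1 - d * k ≤ a → a ≤ y →
      intCount (uncoveredPairs d D) (a + d * k) (y + d * k) = 0 := by
    intro a h1 h2
    have h3 := intCount_mono (uncoveredPairs d D) (a := a + d * k) (b := y + d * k)
      (a' := y - 1) (b' := y + d * k) (by omega) le_rfl
    rw [intCount_uncoveredPairs_pred hd hy (by omega)] at h3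
    have := intCount_nonneg (uncoveredPairs d D) (a + d * k) (y + d * k)
    omega
  have hj' : j * (d - 2) ≤ (k - 1) * (d - 2) := mul_le_mul_of_nonneg_right hjk (by omega)
  by_cases hcov : IsUncovered d D (y - 1)
  · have hz := hD _ hcov
    have hKz : y - 1 - d * k < y := by omega
    have hF : ∀ x ∈ brokenProgression d k (y - 1 - d * k) j (j + 1),
        x ∈ D ∧ y - 1 - d * k ≤ x ∧ x < y := by
      intro x hx
      have hb := brokenProgression_bounds hd (by omega) (by omega) (by omega) hx
      refine ⟨?_, hb.1, by omega⟩
      rcases mem_brokenProgression.1 hx with ⟨i, hi0, hi, rfl⟩ | ⟨i, hi, hik, rfl⟩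
      · rcases hi0.eq_or_lt with rfl | hi0
        · simpa using hz
        · exact hleft i (by omega) hi
      · convert hright i (by omega) (by omega) using 1
        ring
    have hN := card_le_intCount _ hF
    have hcard := card_brokenProgression (k := k) hd (z := y - 1 - d * k) (j₁ := j)
      (j₂ := j + 1) (by omega) (by omega) (by omega)
    have hM1 := hM (y - 1 - d * k) (by omega) (by omega)
    have hlen := hD.length_le hd (by omega) hz hKz.le hy
    have hR0 := intCount_nonneg (uncoveredPairs d D) (y - 1 - d * k) y
    have hS : surplus (2 * d * k - d + 2) (2 * k) (k * d) d (d * k) D (y - 1 - d * k) y =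
        (2 * d * k - d + 2) * (intCount D (y - 1 - d * k) y - k) +
        k * d * (intCount (uncoveredPairs d D) (y - 1 - d * k) y -
          intCount (uncoveredPairs d D) (y - 1 - d * k + d * k) (y + d * k) - 1) := by
      unfold surplus
      ring
    rw [hM1] at hS hlen
    generalize hNe : intCount D (y - 1 - d * k) y = N at *
    generalize hRe : intCount (uncoveredPairs d D) (y - 1 - d * k) y = R at *
    -- The remaining tight case: the known elements exhaust the block, it has one gap `d + 1` at
    -- position `j`, and its surplus is `0`.
    by_cases hexact : N = k ∧ R = 1
    · have hpat : ∀ v ∈ D, y - 1 - d * k ≤ v → v < y - 1 - d * k + d * k + 1 →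
          v ∈ brokenProgression d k (y - 1 - d * k) j (j + 1) := fun v hv h1 h2 =>
        mem_of_intCount_le_card _ hF (by omega) hv h1 (by omega)
      obtain ⟨w, hw, hwz, hwK, hsur⟩ := hD.exists_surplus_of_long_gap hd hdk hj hjk hz
        (K := (t + 1) * (2 * (d * k + 1)) - (d * k + 1)) (by omega) (by
          have h1 := intCount_mono (uncoveredPairs d D) (a := y - 1 - d * k)
            (b := y - 1 - d * k + d * k) (a' := y - 1 - d * k) (b' := y) le_rfl (by omega)
          omega)
        (fun i h1 h2 => by
          convert hD _ (isUncovered_of_brokenProgression_left hd hpat h1 h2 (by omega)) using 1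
          ring)
        (fun i h1 h2 => by
          convert hD _ (isUncovered_of_brokenProgression_right hd (by omega) hpat
            (show j < i by omega) (by omega)) using 1
          ring)
        -- Two blocks further left `j` has grown by one, so `t = k - 1 - j` drops; each round spans
        -- `2(dk + 1)`.
        (fun y' hy' hjk' hyy' hp hl hr => by
          obtain ⟨w, hw, hwz, hwK, hsur⟩ := ih (t - 1) (by omega) (j := j + 1) (by omega)
            (by omega) hy' hp hl hr
          refine ⟨w, hw, hwz, le_trans (le_of_eq ?_) hwK, hsur⟩
          rw [hyy', Nat.cast_sub (by omega)]
          push_cast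
          ring)
      refine ⟨w, hw, by omega, by omega, ?_⟩
      rw [← surplus_add _ _ _ _ _ _ hwz.le hKz.le, hS, hexact.1, hexact.2]
      linarith
    · refine ⟨_, hz, hKz, by omega, ?_⟩
      rw [hS]
      rcases le_or_gt (k + 1) N with h | h
      · have h1 := mul_le_mul_of_nonneg_left (show (1 : ℤ) ≤ N - k by omega) hA
        have h2 := mul_le_mul_of_nonneg_left (show (-1 : ℤ) ≤ R - 0 - 1 by omega) hkd
        nlinarith
      · have h1 : N = k := by omega
        rw [h1] at hlen hexact ⊢
        have h3 : 2 ≤ R := by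
          have : R ≠ 1 := fun h => hexact ⟨rfl, h⟩
          omega
        have h2 := mul_le_mul_of_nonneg_left (show (1 : ℤ) ≤ R - 0 - 1 by omega) hkd
        nlinarith
  · obtain ⟨v, hv, h1, h2⟩ := not_isUncovered_iff.1 hcov
    rcases le_or_gt j (k - 2) with hjk' | hjk'
    · have hyd : y - d ∈ D := by
        convert hright (k - 1) (by omega) (by omega) using 1
        ring
      refine ⟨y - d, hyd, by omega, by omega, ?_⟩
      have hN := two_le_intCount hyd hv (b := y) (by omega) (by omega)
      have hR0 := intCount_nonneg (uncoveredPairs d D) (y - d) y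
      unfold surplus
      rw [hM (y - d) (by omega) (by omega)]
      have h3 := mul_le_mul_of_nonneg_left hN hA
      have h4 := mul_nonneg hkd hR0
      nlinarith
    -- For `j = k - 1` the family `hright` is empty, so the last forced element is `y - 1 - d`
    -- instead of `y - d`.
    · have hyd : y - 1 - d ∈ D := by
        convert hleft (k - 1) (by omega) (by omega) using 1
        ring
      refine ⟨y - 1 - d, hyd, by omega, by omega, ?_⟩
      have hN := two_le_intCount hyd hv (b := y) (by omega) (by omega)
      have hR0 := intCount_nonneg (uncoveredPairs d D) (y - 1 - d) y
      unfold surplus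
      rw [hM (y - 1 - d) (by omega) (by omega)]
      have h3 := mul_le_mul_of_nonneg_left hN hA
      have h4 := mul_nonneg hkd hR0
      nlinarith

/-- A block with `k` gaps `d` and one gap `1` is compensated on its left. -/
theorem IsTileCover.exists_surplus_of_bad_block (hD : IsTileCover d (d * k) D) (hd : 2 ≤ d)
    (hk : 1 ≤ k) (hdk : d ≤ 2 * k + 2) {x : ℤ} (hx : x ∈ D)
    (hunc : IsUncovered d D (x - 1)) (hz : x - 1 - d * k ∈ D)
    (hN : intCount D (x - 1 - d * k) x = k + 1)
    (hR : intCount (uncoveredPairs d D) (x - 1 - d * k) x = 0)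
    (hM : intCount (uncoveredPairs d D) (x - 1 - d * k + d * k) (x + d * k) = 1) :
    ∃ z ∈ D, z < x ∧ x - ((k + 1) * (2 * (d * k + 1))) ≤ z ∧
      0 ≤ surplus (2 * d * k - d + 2) (2 * k) (k * d) d (d * k) D z x := by
  have hdk1 : d * 1 ≤ d * k := mul_le_mul_of_nonneg_left hk (by omega)
  obtain ⟨w, hw, hw1, hw2⟩ := exists_mem_of_intCount_pos (hM ▸ Int.one_pos)
  obtain ⟨v, rfl⟩ : ∃ v, w = v + d * k := ⟨w - d * k, by ring⟩
  obtain ⟨hv, hv'⟩ := mem_of_mem_uncoveredPairs hD hw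
  generalize hye : x - 1 - d * k = y at *
  have hlen : ∀ a b, a ∈ D → b ∈ D → y ≤ a → a ≤ b → b ≤ x → b - a ≤ d * intCount D a b := by
    intro a b ha hb hya hab hbx
    have h1 := hD.length_le hd (by omega) ha hab hb
    have h2 := intCount_mono (uncoveredPairs d D) hya hbx
    have h3 := mul_nonneg (show 0 ≤ d - 1 by omega)
      (intCount_nonneg (uncoveredPairs d D) (a + d * k) (b + d * k))
    omega
  -- If the short gap came first, the uncovered `w + 1` would be `x` itself, which is in `D`. Hence
  -- its position `j` is at least `1`.
  have hvy : v ≠ y := by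
    rintro rfl
    refine hw.2.notMem hd ?_
    convert hx using 1
    omega
  have hvx : v + 1 < x := by
    by_contra! h
    have : v = x - 1 := by omega
    exact hunc.notMem hd (this ▸ hv)
  have h1 := intCount_add D (a := y) (b := v) (c := v + 1) (by omega) (by omega)
  have h2 := intCount_add D (a := y) (b := v + 1) (c := x) (by omega) (by omega)
  have h3 := intCount_eq_one_of_gap hv (b := v + 1) (by omega) (fun x _ _ => by omega)
  have exact1 : ∀ u ∈ D, y ≤ u → u ≤ v → u - y = d * intCount D y u := by
    intro u hu hyu huv
    have h4 := intCount_add D hyu huv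
    have h5 := hlen y u hz hu le_rfl hyu (by omega)
    have h6 := hlen u v hu hv hyu huv (by omega)
    have h7 := hlen (v + 1) x hv' hx (by omega) (by omega) le_rfl
    have : d * intCount D y u + d * intCount D u v + d * intCount D (v + 1) x = d * k := by
      rw [← mul_add, ← mul_add]
      congr 1
      omega
    omega
  have exact2 : ∀ u ∈ D, v + 1 ≤ u → u ≤ x → x - u = d * intCount D u x := by
    intro u hu hyu huv
    have h4 := intCount_add D hyu huv
    have h5 := hlen (v + 1) u hv' hu (by omega) hyu (by omega)
    have h6 := hlen u x hu hx (by omega) huv (by omega)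
    have h7 := hlen y v hz hv (by omega) (by omega) (by omega)
    have : d * intCount D (v + 1) u + d * intCount D u x + d * intCount D y v = d * k := by
      rw [← mul_add, ← mul_add]
      congr 1
      omega
    omega
  have hvj := exact1 v hv (by omega) le_rfl
  have hvj' := exact2 (v + 1) hv' le_rfl (by omega)
  set j := intCount D y v with hj
  have hj1 : 1 ≤ j := by
    by_contra! h
    have : d * j ≤ d * 0 := mul_le_mul_of_nonneg_left (by omega) (by omega)
    omega
  have hjk : j ≤ k - 1 := by
    by_contra! h
    have : d * k ≤ d * j := mul_le_mul_of_nonneg_left (by omega) (by omega)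
    omega
  have hpat : ∀ u ∈ D, y ≤ u → u < y + d * k + 1 → u ∈ brokenProgression d k y j j := by
    intro u hu h4 h5
    rw [mem_brokenProgression]
    rcases le_or_gt u v with huv | huv
    · left
      have h6 := exact1 u hu h4 huv
      refine ⟨intCount D y u, intCount_nonneg _ _ _, ?_, by rw [mul_comm]; omega⟩
      exact intCount_mono D le_rfl huv
    · right
      have h6 := exact2 u hu (by omega) (by omega)
      have h7 := intCount_mono D (a := u) (b := x) (a' := v + 1) (b' := x) (by omega) le_rfl
      have h8 : 1 ≤ intCount D u x := by
        by_contra! h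
        have : d * intCount D u x ≤ d * 0 := mul_le_mul_of_nonneg_left (by omega) (by omega)
        omega
      refine ⟨k - intCount D u x, by omega, by omega, ?_⟩
      rw [sub_mul, mul_comm k, mul_comm _ d]
      omega
  obtain ⟨z, hz', hzy, hzK, hsur⟩ := hD.exists_surplus_of_short_gap hd hdk (k - 1 - j).toNat
    (j := j) (y := y) (by omega) hj1 hz (by
      have h1 := intCount_mono (uncoveredPairs d D) (a := y)
        (b := y + d * k) (a' := y) (b' := x) le_rfl (by omega)
      have h2 := intCount_nonneg (uncoveredPairs d D) y (y + d * k)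
      omega)
    (fun i h1 h2 => by
      convert hD _ (isUncovered_of_brokenProgression_left hd hpat h1 h2 (by omega)) using 1
      ring)
    (fun i h1 h2 => by
      convert hD _ (isUncovered_of_brokenProgression_right hd (by omega) hpat h1
        (by omega)) using 1
      ring)
  refine ⟨z, hz', by omega, ?_, ?_⟩
  · have : (((k - 1 - j).toNat : ℤ) + 1) * (2 * (d * k + 1)) ≤ k * (2 * (d * k + 1)) :=
      mul_le_mul_of_nonneg_right (by omega) (by omega)
    have e : (k + 1) * (2 * (d * k + 1)) = k * (2 * (d * k + 1)) + 2 * (d * k + 1) := by ring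
    omega
  · rw [← surplus_add _ _ _ _ _ _ hzy.le (show y ≤ x by omega)]
    have hS : surplus (2 * d * k - d + 2) (2 * k) (k * d) d (d * k) D y x = -(d - 2) := by
      unfold surplus
      rw [hN, hR, hM, ← hye]
      ring
    have : 1 * (d - 2) ≤ j * (d - 2) := mul_le_mul_of_nonneg_right hj1 (by omega)
    linarith

/-- The lower bound when `s = d * k` and `d ≤ 2 * k + 2`. -/
theorem IsTileCover.le_density_of_eq_mul (hD : IsTileCover d (d * k) D) (hd : 2 ≤ d)
    (hk : 1 ≤ k) (hdk : d ≤ 2 * k + 2) :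
    ((2 * k : ℤ) : ℝ) / ((2 * d * k - d + 2 : ℤ) : ℝ) ≤ intLowerDensity D := by
  have hkd : 0 ≤ k * d := mul_nonneg (by omega) (by omega)
  have hdk1 : d * 1 ≤ d * k := mul_le_mul_of_nonneg_left hk (by omega)
  have hA : 0 < 2 * d * k - d + 2 := by nlinarith
  -- The choice `δ = kd` gives the block with one gap `d + 1` surplus `0`. The short-gap condition
  -- `B(d - 1) ≤ A` is exactly `d ≤ 2k + 2`, and `B + δ ≤ A` is `(k - 1)(d - 2) ≥ 0`.
  refine hD.le_intLowerDensity_of_cases (δ := k * d) (K := (k + 1) * (2 * (d * k + 1))) hd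
    (by omega) hA (by omega) hkd (by nlinarith)
    (by nlinarith [mul_nonneg (show 0 ≤ k - 1 by omega) (show 0 ≤ d - 2 by omega)])
    fun x hx hunc hz => ?_
  have hzx : x - 1 - d * k < x := by omega
  have hlen := hD.length_le hd (by omega) hz hzx.le hx
  by_cases hbad : intCount D (x - 1 - d * k) x = k + 1 ∧
      intCount (uncoveredPairs d D) (x - 1 - d * k) x = 0 ∧
      intCount (uncoveredPairs d D) (x - 1 - d * k + d * k) (x + d * k) = 1
  · exact hD.exists_surplus_of_bad_block hd hk hdk hx hunc hz hbad.1 hbad.2.1 hbad.2.2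
  refine ⟨_, hz, hzx, by nlinarith, ?_⟩
  have hN0 := intCount_nonneg D (x - 1 - d * k) x
  have hR0 := intCount_nonneg (uncoveredPairs d D) (x - 1 - d * k) x
  have hM0 := intCount_nonneg (uncoveredPairs d D) (x - 1 - d * k + d * k) (x + d * k)
  unfold surplus
  generalize intCount D (x - 1 - d * k) x = N at *
  generalize intCount (uncoveredPairs d D) (x - 1 - d * k) x = R at *
  generalize intCount (uncoveredPairs d D) (x - 1 - d * k + d * k) (x + d * k) = M at *
  -- In terms of `q = N - M - k` the gap inequality becomes `1 ≤ R + M + dq`, and the case split is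
  -- on the sign of `q`.
  obtain ⟨q, rfl⟩ : ∃ q, N = q + M + k := ⟨N - M - k, by ring⟩
  have hlen' : 1 ≤ R + M + d * q := by linarith
  have hgoal : 0 ≤ (2 * d * k - d + 2) * q + (k * d - d + 2) * M + k * d * (R - 1) := by
    have hA' : 0 ≤ k * d - d + 2 := by nlinarith
    rcases lt_trichotomy q 0 with hq | rfl | hq
    · obtain ⟨n, rfl⟩ : ∃ n, q = -n := ⟨-q, by ring⟩
      have h1 : 0 ≤ (d - 2) * (n * (k * d - d + 1) - 1) := by
        refine mul_nonneg (by omega) ?_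
        have := mul_le_mul (show 1 ≤ n by omega) (show 1 ≤ k * d - d + 1 by linarith)
          (by omega) (by omega)
        omega
      rcases le_or_gt (1 + d * n) M with hM | hM
      · have h2 := mul_le_mul_of_nonneg_left hM hA'
        have h3 := mul_le_mul_of_nonneg_left (show -1 ≤ R - 1 by omega) hkd
        linarith
      · have h2 := mul_le_mul_of_nonneg_left (show d * n - M ≤ R - 1 by linarith) hkd
        have h3 := mul_le_mul_of_nonneg_left (show M ≤ 1 + d * n by omega)
          (show 0 ≤ d - 2 by omega)
        linarith
    · rcases hR0.eq_or_lt with rfl | hR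
      · have : M ≠ 1 := fun h => hbad ⟨by omega, rfl, h⟩
        have hM2 : 2 ≤ M := by omega
        have := mul_le_mul_of_nonneg_left hM2 hA'
        rcases hk.eq_or_lt with rfl | hk2
        · linarith
        · have := mul_le_mul_of_nonneg_right (show 2 ≤ k by omega) (show 0 ≤ d by omega)
          linarith
      · have h1 := mul_nonneg hA' hM0
        have h2 := mul_nonneg hkd (show 0 ≤ R - 1 by omega)
        linarith
    · have h1 := mul_nonneg hA' hM0
      have h2 := mul_le_mul_of_nonneg_left (show -1 ≤ R - 1 by omega) hkd
      have h3 := mul_le_mul_of_nonneg_left (show 1 ≤ q by omega) hA.le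
      linarith
  convert hgoal using 1
  ring

/-! ### Lower bounds in the remaining cases. -/

/-- Leaving `A` and `B` free up to the two inequalities serves both ratios, `(k + 1)/(dk + e)` and
`1/(d - 1)`. -/
theorem IsTileCover.le_density_of_two_le {e A B : ℤ} (hD : IsTileCover d (d * k + e - 1) D)
    (hd : 3 ≤ d) (hk : 1 ≤ k) (he : 2 ≤ e) (hB : 0 < B) (h1 : B * (d - 1) ≤ A)
    (h2 : B * (d * k + e) ≤ A * (k + 1)) : (B : ℝ) / A ≤ intLowerDensity D := by
  have hdk1 : d * 1 ≤ d * k := mul_le_mul_of_nonneg_left hk (by omega)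
  have hA : 2 * B ≤ A := by nlinarith
  -- Doubling `A` and `B` makes the weight `δ = A/2` integral. The surplus is then at least `A(2(q -
  -- 1) + R + M)`, nonnegative because `R + M ≥ 2 - dq` and `d ≥ 2`.
  have := hD.le_intLowerDensity_of_cases (A := 2 * A) (B := 2 * B) (δ := A) (K := d * k + e)
    (by omega) (by omega) (by omega) (by omega) (by omega) (by linarith) (by omega)
    fun x hx hunc hz => by
      refine ⟨_, hz, by omega, by omega, ?_⟩
      have hlen := hD.length_le (by omega) (by omega) hz (by omega) hx
      have hR0 := intCount_nonneg (uncoveredPairs d D) (x - 1 - (d * k + e - 1)) x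
      have hM0 := intCount_nonneg (uncoveredPairs d D)
        (x - 1 - (d * k + e - 1) + (d * k + e - 1)) (x + (d * k + e - 1))
      unfold surplus
      generalize intCount D (x - 1 - (d * k + e - 1)) x = N at *
      generalize intCount (uncoveredPairs d D) (x - 1 - (d * k + e - 1)) x = R at *
      generalize intCount (uncoveredPairs d D)
        (x - 1 - (d * k + e - 1) + (d * k + e - 1)) (x + (d * k + e - 1)) = M at *
      obtain ⟨q, rfl⟩ : ∃ q, N = q + M + k := ⟨N - M - k, by ring⟩
      have hlen' : 2 ≤ R + M + d * q := by linarith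
      have key : 0 ≤ 2 * (q - 1) + R + M := by
        rcases le_or_gt q 0 with hq | hq
        · nlinarith
        · omega
      have := mul_nonneg (show 0 ≤ A by omega) key
      linarith
  push_cast at this
  rwa [mul_div_mul_left _ _ two_ne_zero] at this

/-- The lower bound when `s = d * k` and `d > 2 * k + 2`. -/
theorem IsTileCover.le_density_of_lt (hD : IsTileCover d (d * k) D) (hk : 1 ≤ k)
    (hdk : 2 * k + 2 < d) : (1 : ℝ) / ((d - 1 : ℤ) : ℝ) ≤ intLowerDensity D := by
  have hdk1 : d * 1 ≤ d * k := mul_le_mul_of_nonneg_left hk (by omega)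
  have := hD.le_intLowerDensity_of_cases (A := d - 1) (B := 1) (δ := k + 1) (K := d * k + 1)
    (by omega) (by omega) (by omega) (by omega) (by omega) (by linarith) (by omega)
    fun x hx hunc hz => by
      refine ⟨_, hz, by omega, by omega, ?_⟩
      have hlen := hD.length_le (by omega) (by omega) hz (by omega) hx
      have hR0 := intCount_nonneg (uncoveredPairs d D) (x - 1 - d * k) x
      have hM0 := intCount_nonneg (uncoveredPairs d D) (x - 1 - d * k + d * k) (x + d * k)
      unfold surplus
      generalize intCount D (x - 1 - d * k) x = N at *
      generalize intCount (uncoveredPairs d D) (x - 1 - d * k) x = R at *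
      generalize intCount (uncoveredPairs d D) (x - 1 - d * k + d * k) (x + d * k) = M at *
      obtain ⟨q, rfl⟩ : ∃ q, N = q + M + k := ⟨N - M - k, by ring⟩
      have hlen' : 1 ≤ R + M + d * q := by linarith
      have hgoal : 0 ≤ (d - 1) * q + (d - 1) * M - (k + 1) + (k + 1) * (R - M) := by
        rcases le_or_gt q 0 with hq | hq
        · nlinarith
        · nlinarith
      linarith
  simpa using this
end

/-! ### Domination as tile covering, and reflection. -/

theorem isDominatingSet_iff_isTileCover {d s : ℤ} (hd : 2 ≤ d) {D : Set ℤ} :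
    (cayleyDigraph (Set.Icc (1 : ℤ) (d - 2) ∪ {s})).IsDominatingSet D ↔ IsTileCover d s D := by
  constructor
  · intro h w hw
    obtain ⟨u, hu, rfl | ⟨x, hx, hwx⟩⟩ := h w
    · exact absurd hu (hw.notMem hd)
    · change w = u + x at hwx
      rcases hx with hx | hx
      · rw [Set.mem_Icc] at hx
        exact absurd ⟨by omega, by omega⟩ (hw u hu)
      · rw [Set.mem_singleton_iff] at hx
        have : w - s = u := by omega
        rwa [this]
  · intro h w
    by_cases hw : IsUncovered d D w
    · exact ⟨_, h w hw, Or.inr ⟨s, Or.inr rfl, by ring⟩⟩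
    · obtain ⟨v, hv, h1, h2⟩ := not_isUncovered_iff.1 hw
      refine ⟨v, hv, ?_⟩
      rcases h2.eq_or_lt with h2 | h2
      · exact Or.inl h2
      · exact Or.inr ⟨w - v, Or.inl (Set.mem_Icc.2 ⟨by omega, by omega⟩), by ring⟩

/-- The map `t ↦ d - 2 - t` preserves `{0, …, d - 2}` and sends `s` to `d - 2 - s`. -/
theorem IsTileCover.neg {d s : ℤ} {D : Set ℤ} (hD : IsTileCover d s D) :
    IsTileCover d (d - 2 - s) {x | -x ∈ D} := by
  intro w hw
  have : IsUncovered d D (-w + (d - 2)) := fun v hv h =>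
    hw (-v) (by simpa using hv) ⟨by omega, by omega⟩
  have := hD _ this
  change -(w - (d - 2 - s)) ∈ D
  convert this using 1
  ring

theorem intLowerDensity_neg (D : Set ℤ) : intLowerDensity {x | -x ∈ D} = intLowerDensity D := by
  unfold intLowerDensity
  congr 1
  ext n
  congr 2
  have : {x | -x ∈ D} ∩ Set.Icc (-(n : ℤ)) n = (fun x => -x) '' (D ∩ Set.Icc (-(n : ℤ)) n) := by
    ext x
    simp only [Set.mem_inter_iff, Set.mem_ofPred_eq, Set.mem_Icc, Set.mem_image]
    constructor
    · rintro ⟨h1, h2, h3⟩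
      exact ⟨-x, ⟨h1, by omega, by omega⟩, by ring⟩
    · rintro ⟨y, ⟨h1, h2, h3⟩, rfl⟩
      exact ⟨by simpa using h1, by omega, by omega⟩
  rw [this, Set.ncard_image_of_injective _ neg_injective]

theorem dominationRatio_eq {d s : ℤ} (hd : 2 ≤ d) {c : ℝ}
    (hlow : ∀ D, IsTileCover d s D → c ≤ intLowerDensity D)
    (hup : ∃ D, IsTileCover d s D ∧ intLowerDensity D ≤ c) :
    dominationRatio (Set.Icc (1 : ℤ) (d - 2) ∪ {s}) = c := by
  obtain ⟨D, hD, hc⟩ := hup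
  refine IsLeast.csInf_eq ⟨⟨D, (isDominatingSet_iff_isTileCover hd).2 hD, hc.antisymm (hlow D hD)⟩,
    ?_⟩
  rintro _ ⟨E, hE, rfl⟩
  exact hlow E ((isDominatingSet_iff_isTileCover hd).1 hE)

theorem dominationRatio_reflect {d s : ℤ} (hd : 2 ≤ d) :
    dominationRatio (Set.Icc (1 : ℤ) (d - 2) ∪ {d - 2 - s}) =
      dominationRatio (Set.Icc (1 : ℤ) (d - 2) ∪ {s}) := by
  have key : ∀ s, intLowerDensity ''
      {D : Set ℤ | (cayleyDigraph (Set.Icc (1 : ℤ) (d - 2) ∪ {s})).IsDominatingSet D} ⊆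
      intLowerDensity '' {D : Set ℤ |
        (cayleyDigraph (Set.Icc (1 : ℤ) (d - 2) ∪ {d - 2 - s})).IsDominatingSet D} := by
    rintro s _ ⟨D, hD, rfl⟩
    exact ⟨_, (isDominatingSet_iff_isTileCover hd).2
      ((isDominatingSet_iff_isTileCover hd).1 hD).neg, intLowerDensity_neg D⟩
  unfold dominationRatio
  congr 1
  refine (Set.Subset.antisymm (key s) ?_).symm
  have h := key (d - 2 - s)
  rwa [sub_sub_cancel] at h

/-! ### Periodic covers and the upper bounds. -/

/-- The union of the residue classes modulo `p` of the elements of `F`. -/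
def periodicSet (p : ℤ) (F : Finset ℤ) : Set ℤ := {x | ∃ r ∈ F, ∃ m, x = r + p * m}

theorem intCount_residueClass_le {p : ℤ} (hp : 0 < p) (r a b : ℤ) (hab : a ≤ b) :
    (intCount {x | x ≡ r [ZMOD p]} a b : ℝ) ≤ (b - a) / p + 1 := by
  classical
  have hp' : (0 : ℝ) < p := by exact_mod_cast hp
  have h := Int.Ico_filter_modEq_card a b hp r
  have h2 : intCount {x | x ≡ r [ZMOD p]} a b =
      max (⌈(b - r) / (p : ℚ)⌉ - ⌈(a - r) / (p : ℚ)⌉) 0 := by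
    rw [← h, intCount, Nat.cast_inj]
    refine congrArg Finset.card (Finset.ext fun x => ?_)
    simp only [Finset.mem_filter, Set.mem_ofPred_eq]
  have h3 : (⌈(b - r) / (p : ℚ)⌉ : ℚ) < (b - r) / (p : ℚ) + 1 := Int.ceil_lt_add_one _
  have h4 : (a - r) / (p : ℚ) ≤ (⌈(a - r) / (p : ℚ)⌉ : ℚ) := Int.le_ceil _
  have h5 : ((⌈(b - r) / (p : ℚ)⌉ - ⌈(a - r) / (p : ℚ)⌉ : ℤ) : ℚ) ≤ (b - a) / p + 1 := by
    push_cast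
    have : ((b : ℚ) - a) / p = (b - r) / p - (a - r) / p := by ring
    linarith
  have h6 : (0 : ℚ) ≤ (b - a) / p + 1 := by
    have : (0 : ℚ) ≤ b - a := by
      rw [sub_nonneg]
      exact_mod_cast hab
    have : (0 : ℚ) ≤ p := by exact_mod_cast hp.le
    positivity
  have h7 : (intCount {x | x ≡ r [ZMOD p]} a b : ℚ) ≤ (b - a) / p + 1 := by
    rw [h2, Int.cast_max]
    exact max_le h5 (by simpa using h6)
  exact_mod_cast h7

theorem intCount_periodicSet_le (p : ℤ) (F : Finset ℤ) (a b : ℤ) :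
    intCount (periodicSet p F) a b ≤ ∑ r ∈ F, intCount {x | x ≡ r [ZMOD p]} a b := by
  classical
  unfold intCount
  rw [← Nat.cast_sum, Nat.cast_le]
  refine le_trans (Finset.card_le_card fun x hx => ?_) Finset.card_biUnion_le
  simp only [Finset.mem_filter, Finset.mem_biUnion] at hx ⊢
  obtain ⟨hx, r, hr, m, rfl⟩ := hx
  exact ⟨r, hr, hx, (Int.modEq_iff_dvd.2 ⟨-m, by ring⟩)⟩

theorem intLowerDensity_periodicSet_le {p : ℤ} (hp : 0 < p) (F : Finset ℤ) :
    intLowerDensity (periodicSet p F) ≤ (F.card : ℝ) / p := by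
  refine intLowerDensity_le_of_count (C := F.card) fun n => ?_
  have h1 : (intCount (periodicSet p F) (-n) (n + 1) : ℝ) ≤
      ∑ r ∈ F, (intCount {x | x ≡ r [ZMOD p]} (-n) (n + 1) : ℝ) := by
    exact_mod_cast intCount_periodicSet_le p F (-n) (n + 1)
  refine h1.trans ((Finset.sum_le_card_nsmul F _ _ fun r _ =>
    intCount_residueClass_le hp r (-n) (n + 1) (by omega)).trans (le_of_eq ?_))
  rw [nsmul_eq_mul]
  push_cast
  ring

theorem isTileCover_periodicSet {d s p : ℤ} {F : Finset ℤ} (hp : 0 < p)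
    (h : ∀ w, 0 ≤ w → w < p → ∃ r ∈ F, (w - (d - 2) ≤ r ∧ r ≤ w) ∨ ∃ m, w - s = r + p * m) :
    IsTileCover d s (periodicSet p F) := by
  intro w hw
  have hmod := Int.emod_add_mul_ediv w p
  obtain ⟨r, hr, h1 | ⟨m, hm⟩⟩ := h (w % p) (Int.emod_nonneg _ hp.ne') (Int.emod_lt_of_pos _ hp)
  · exact absurd ⟨by omega, by omega⟩ (hw (r + p * (w / p)) ⟨r, hr, _, rfl⟩)
  · exact ⟨r, hr, m + w / p, by rw [mul_add]; omega⟩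

theorem exists_isTileCover_trivial {d s : ℤ} (hd : 2 ≤ d) :
    ∃ D, IsTileCover d s D ∧ intLowerDensity D ≤ 1 / ((d : ℝ) - 1) := by
  refine ⟨periodicSet (d - 1) {0}, isTileCover_periodicSet (by omega) fun w h1 h2 =>
    ⟨0, by simp, Or.inl ⟨by omega, h1⟩⟩, ?_⟩
  simpa using intLowerDensity_periodicSet_le (show 0 < d - 1 by omega) {0}

/-- The period `dk + e = s + 1` consists of `k` gaps `d` and one gap `e`. Modulo `s + 1`,
subtracting `s` is adding `1`, so the last integer of each gap `d` is covered from the next element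
of `D`. -/
theorem exists_isTileCover_of_le {d k e : ℤ} (hd : 2 ≤ d) (hk : 1 ≤ k) (he : 1 ≤ e)
    (he' : e ≤ d - 1) : ∃ D, IsTileCover d (d * k + e - 1) D ∧
      intLowerDensity D ≤ ((k : ℝ) + 1) / ((d : ℝ) * k + e) := by
  have hp : 0 < d * k + e := by nlinarith
  refine ⟨periodicSet (d * k + e) ((Finset.Icc 0 k).image fun i => i * d),
    isTileCover_periodicSet hp fun w h1 h2 => ?_, ?_⟩
  · have hmod := Int.emod_add_mul_ediv w d
    have hm0 := Int.emod_nonneg w (show d ≠ 0 by omega)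
    have hmd := Int.emod_lt_of_pos w (show 0 < d by omega)
    have hi0 : 0 ≤ w / d := Int.ediv_nonneg h1 (by omega)
    generalize w / d = i at *
    generalize w % d = ρ at *
    have hik : i ≤ k := by
      by_contra! hc
      have : d * (k + 1) ≤ d * i := mul_le_mul_of_nonneg_left (by omega) (by omega)
      rw [mul_add] at this
      omega
    rcases le_or_gt ρ (d - 2) with hρ | hρ
    · refine ⟨i * d, Finset.mem_image_of_mem _ (Finset.mem_Icc.2 ⟨hi0, hik⟩), Or.inl ?_⟩
      rw [mul_comm i d]
      omega
    · have hik' : i ≠ k := by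
        rintro rfl
        omega
      refine ⟨(i + 1) * d, Finset.mem_image_of_mem (fun i => i * d)
        (Finset.mem_Icc.2 ⟨by omega, by omega⟩), Or.inr ⟨-1, ?_⟩⟩
      have : ρ = d - 1 := by omega
      rw [← hmod, this]
      ring
  · refine (intLowerDensity_periodicSet_le hp _).trans ?_
    push_cast
    have hp' : (0 : ℝ) < (d : ℝ) * k + e := by exact_mod_cast hp
    gcongr
    have := Finset.card_image_le (s := Finset.Icc 0 k) (f := fun i => i * d)
    rw [Int.card_Icc] at this
    have : ((Finset.image (fun i => i * d) (Finset.Icc 0 k)).card : ℤ) ≤ k + 1 := by omega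
    exact_mod_cast this

/-- The extremal pattern of the chain argument: `2k - 2` gaps `d`, one gap `d + 1` and one gap `1`
per period. The gap `1`, closing the period, pays for the uncovered pair `dk - 1, dk` of the long
gap. -/
theorem exists_isTileCover_of_eq_mul {d k : ℤ} (hd : 2 ≤ d) (hk : 1 ≤ k) :
    ∃ D, IsTileCover d (d * k) D ∧
      intLowerDensity D ≤ ((2 * k : ℤ) : ℝ) / ((2 * d * k - d + 2 : ℤ) : ℝ) := by
  have hp : 0 < 2 * d * k - d + 2 := by nlinarith
  refine ⟨periodicSet (2 * d * k - d + 2) (brokenProgression d (2 * k) 0 (k - 1) k),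
    isTileCover_periodicSet hp fun w h1 h2 => ?_, ?_⟩
  · have hmem1 : ∀ i, 0 ≤ i → i ≤ k - 1 → i * d ∈ brokenProgression d (2 * k) 0 (k - 1) k :=
      fun i h h' => mem_brokenProgression.2 (Or.inl ⟨i, h, h', by ring⟩)
    have hmem2 : ∀ i, k ≤ i → i ≤ 2 * k - 1 →
        1 + i * d ∈ brokenProgression d (2 * k) 0 (k - 1) k :=
      fun i h h' => mem_brokenProgression.2 (Or.inr ⟨i, h, h', by ring⟩)
    rcases lt_trichotomy w (d * k) with hw | rfl | hw
    · have hmod := Int.emod_add_mul_ediv w d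
      have hm0 := Int.emod_nonneg w (show d ≠ 0 by omega)
      have hmd := Int.emod_lt_of_pos w (show 0 < d by omega)
      have hi0 : 0 ≤ w / d := Int.ediv_nonneg h1 (by omega)
      generalize w / d = i at *
      generalize w % d = ρ at *
      have hik : i ≤ k - 1 := by
        by_contra! hc
        have : d * k ≤ d * i := mul_le_mul_of_nonneg_left (by omega) (by omega)
        omega
      rcases le_or_gt ρ (d - 2) with hρ | hρ
      · refine ⟨i * d, hmem1 i hi0 hik, Or.inl ?_⟩
        rw [mul_comm i d]
        omega
      · refine ⟨1 + (i + k) * d, hmem2 _ (by omega) (by omega), Or.inr ⟨-1, ?_⟩⟩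
        have : ρ = d - 1 := by omega
        rw [← hmod, this]
        ring
    · exact ⟨0 * d, hmem1 0 le_rfl (by omega), Or.inr ⟨0, by ring⟩⟩
    · have hmod := Int.emod_add_mul_ediv (w - 1) d
      have hm0 := Int.emod_nonneg (w - 1) (show d ≠ 0 by omega)
      have hmd := Int.emod_lt_of_pos (w - 1) (show 0 < d by omega)
      generalize (w - 1) / d = i at *
      generalize (w - 1) % d = ρ at *
      have hik : k ≤ i := by
        by_contra! hc
        have : d * i ≤ d * (k - 1) := mul_le_mul_of_nonneg_left (by omega) (by omega)
        rw [mul_sub] at this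
        omega
      have hik2 : i ≤ 2 * k - 1 := by
        by_contra! hc
        have : d * (2 * k) ≤ d * i := mul_le_mul_of_nonneg_left (by omega) (by omega)
        have e1 : d * (2 * k) = 2 * d * k := by ring
        omega
      rcases le_or_gt ρ (d - 2) with hρ | hρ
      · refine ⟨1 + i * d, hmem2 i hik hik2, Or.inl ?_⟩
        rw [mul_comm i d]
        omega
      · have hρ' : ρ = d - 1 := by omega
        have hik3 : i ≠ 2 * k - 1 := by
          rintro rfl
          have e1 : d * (2 * k - 1) = 2 * d * k - d := by ring
          omega
        refine ⟨(i + 1 - k) * d, hmem1 _ (by omega) (by omega), Or.inr ⟨0, ?_⟩⟩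
        have : w = d * i + d := by omega
        rw [this]
        ring
  · refine (intLowerDensity_periodicSet_le hp _).trans (le_of_eq ?_)
    congr 1
    have := card_brokenProgression (k := 2 * k) hd (z := 0) (j₁ := k - 1) (j₂ := k) (by omega)
      (by omega) (by omega)
    have h2 : ((brokenProgression d (2 * k) 0 (k - 1) k).card : ℤ) = 2 * k := by omega
    exact_mod_cast h2

/-! ### The value by cases and the comparison of the three ratios. -/

theorem dominationRatio_eq_ite {d k e : ℤ} (hd : 2 ≤ d) (hk : 1 ≤ k) (he : 1 ≤ e)
    (he' : e ≤ d - 1) :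
    dominationRatio (Set.Icc (1 : ℤ) (d - 2) ∪ {d * k + e - 1}) =
      if 2 ≤ e ∧ d ≤ k + e + 1 then ((k : ℝ) + 1) / ((d : ℝ) * k + e)
        else if e = 1 ∧ d ≤ 2 * k + 2 then
          (2 * (k : ℝ) + e - 1) / (2 * (d : ℝ) * k - d + 2 * e)
        else 1 / ((d : ℝ) - 1) := by
  split_ifs with h1 h2
  · refine dominationRatio_eq hd (fun D hD => ?_) (exists_isTileCover_of_le hd hk he he')
    have := hD.le_density_of_two_le (A := d * k + e) (B := k + 1) (by omega) hk h1.1 (by omega)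
      (by linarith) (by linarith)
    push_cast at this
    exact this
  · obtain ⟨rfl, hdk⟩ := h2
    have e1 : d * k + 1 - 1 = d * k := by ring
    have e2 : (2 * (k : ℝ) + (1 : ℤ) - 1) / (2 * (d : ℝ) * k - d + 2 * (1 : ℤ)) =
        ((2 * k : ℤ) : ℝ) / ((2 * d * k - d + 2 : ℤ) : ℝ) := by
      push_cast
      ring
    rw [e1, e2]
    exact dominationRatio_eq hd (fun D hD => hD.le_density_of_eq_mul hd hk hdk)
      (exists_isTileCover_of_eq_mul hd hk)
  · refine dominationRatio_eq hd (fun D hD => ?_) (exists_isTileCover_trivial hd)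
    rcases he.eq_or_lt with rfl | he2
    · have e1 : d * k + 1 - 1 = d * k := by ring
      rw [e1] at hD
      have := hD.le_density_of_lt hk (by omega)
      push_cast at this
      exact this
    · have hlt : k + e + 1 < d := by omega
      have := hD.le_density_of_two_le (A := d - 1) (B := 1) (by omega) hk (by omega) (by omega)
        (by omega) (by linarith)
      push_cast at this
      exact this

theorem min_ratios_eq_ite {d k e : ℤ} (hd : 2 ≤ d) (hk : 1 ≤ k) (he : 1 ≤ e)
    (he' : e ≤ d - 1) :
    min (((k : ℝ) + 1) / ((d : ℝ) * k + e))
      (min ((2 * (k : ℝ) + e - 1) / (2 * (d : ℝ) * k - d + 2 * e)) (1 / ((d : ℝ) - 1))) =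
      if 2 ≤ e ∧ d ≤ k + e + 1 then ((k : ℝ) + 1) / ((d : ℝ) * k + e)
        else if e = 1 ∧ d ≤ 2 * k + 2 then
          (2 * (k : ℝ) + e - 1) / (2 * (d : ℝ) * k - d + 2 * e)
        else 1 / ((d : ℝ) - 1) := by
  have hd' : (2 : ℝ) ≤ d := by exact_mod_cast hd
  have hk' : (1 : ℝ) ≤ k := by exact_mod_cast hk
  have he1 : (1 : ℝ) ≤ e := by exact_mod_cast he
  have hed : (e : ℝ) ≤ d - 1 := by exact_mod_cast he'
  have p1 : 0 < (d : ℝ) * k + e := by positivity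
  have p2 : 0 < 2 * (d : ℝ) * k - d + 2 * e := by nlinarith
  have p3 : 0 < (d : ℝ) - 1 := by linarith
  split_ifs with h1 h2
  · have h3 : (2 : ℝ) ≤ e := by exact_mod_cast h1.1
    have h4 : (d : ℝ) ≤ k + e + 1 := by exact_mod_cast h1.2
    rw [min_eq_left]
    refine le_min ?_ ?_
    · rw [div_le_div_iff₀ p1 p2]
      nlinarith [mul_nonneg (mul_nonneg (show (0 : ℝ) ≤ d by linarith)
        (show (0 : ℝ) ≤ k by linarith)) (show (0 : ℝ) ≤ e - 2 by linarith)]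
    · rw [div_le_div_iff₀ p1 p3]
      linarith
  · obtain ⟨rfl, hdk⟩ := h2
    have h4 : (d : ℝ) ≤ 2 * k + 2 := by exact_mod_cast hdk
    push_cast at *
    have h5 : (2 * (k : ℝ) + 1 - 1) / (2 * d * k - d + 2 * 1) ≤ 1 / (d - 1) := by
      rw [div_le_div_iff₀ p2 p3]
      linarith
    rw [min_eq_left h5, min_eq_right]
    rw [div_le_div_iff₀ p2 p1]
    nlinarith
  · rcases he.eq_or_lt with rfl | he2
    · have h4 : (2 * k + 2 : ℝ) ≤ d := by
        have : 2 * k + 2 ≤ d := by omega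
        exact_mod_cast this
      push_cast at *
      have h5 : 1 / ((d : ℝ) - 1) ≤ (2 * (k : ℝ) + 1 - 1) / (2 * d * k - d + 2 * 1) := by
        rw [div_le_div_iff₀ p3 p2]
        linarith
      rw [min_eq_right h5, min_eq_right]
      rw [div_le_div_iff₀ p3 p1]
      linarith
    · have h3 : (2 : ℝ) ≤ e := by exact_mod_cast he2
      have h4 : (k + e + 1 : ℝ) ≤ d := by
        have : k + e + 1 ≤ d := by omega
        exact_mod_cast this
      have h5 : 1 / ((d : ℝ) - 1) ≤ (2 * (k : ℝ) + e - 1) / (2 * d * k - d + 2 * e) := by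
        rw [div_le_div_iff₀ p3 p2]
        nlinarith
      rw [min_eq_right h5, min_eq_right]
      rw [div_le_div_iff₀ p3 p1]
      linarith

theorem mainTheorem1 (d s k e : ℤ) (hd : 2 ≤ d) (hs : s ∉ Set.Icc (0 : ℤ) (d - 2))
    (hk : 1 ≤ k) (he : e ∈ Set.Icc (1 : ℤ) (d - 1))
    (hske : s = d * k + e - 1 ∨ s = -(d * k) + d - e - 1) :
    dominationRatio (Set.Icc (1 : ℤ) (d - 2) ∪ {s}) =
        min (((k : ℝ) + 1) / ((d : ℝ) * k + e))
          (min ((2 * (k : ℝ) + e - 1) / (2 * (d : ℝ) * k - d + 2 * e)) (1 / ((d : ℝ) - 1))) ∧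
      dominationRatio (Set.Icc (1 : ℤ) (d - 2) ∪ {s}) =
        (if 2 ≤ e ∧ d ≤ k + e + 1 then ((k : ℝ) + 1) / ((d : ℝ) * k + e)
        else if e = 1 ∧ d ≤ 2 * k + 2 then
          (2 * (k : ℝ) + e - 1) / (2 * (d : ℝ) * k - d + 2 * e)
        else 1 / ((d : ℝ) - 1)) := by
  have key : dominationRatio (Set.Icc (1 : ℤ) (d - 2) ∪ {s}) =
      dominationRatio (Set.Icc (1 : ℤ) (d - 2) ∪ {d * k + e - 1}) := by
    rcases hske with rfl | rfl
    · rfl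
    · rw [← dominationRatio_reflect hd]
      congr 3
      ring
  rw [min_ratios_eq_ite hd hk he.1 he.2, key, and_self]
  exact dominationRatio_eq_ite hd hk he.1 he.2
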